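/- Let $H$ be a finite-dimensional Hopf algebra over a field $\Bbbk$, with multiplication $m$, comultiplication $\Delta$, counit $\varepsilon$ and antipode $S$. Let $\Delta^{(1)}=\mathrm{id}_H$ and $\Delta^{(n+1)}=(\mathrm{id}\otimes\Delta^{(n)})\circ\Delta$ for $n\ge 1$, let $m^{(n)}:H^{\otimes n}\to H$ be the multiplication map, and define the Sweedler powers of $h \in H$ by $P_0(h)=h^{[0]}=\varepsilon(h)1$ and $P_n(h)=h^{[n]}=m^{(n)}(\Delta^{(n)}(h))$ for $n\ge 1$. For every positive integer $n$ put $\nu_n(H)=\operatorname{Tr}(S\circ P_{n-1})$. A 2-cocycle of $H$ is an invertible element $F\in H\otimes H$ such that $(\varepsilon\otimes\mathrm{id})(F)=(\mathrm{id}\otimes\varepsilon)(F)=1$ and $$(1\otimes F)(\mathrm{id}\otimes\Delta)(F)(\Delta\otimes\mathrm{id})(F^{-1})(F^{-1}\otimes 1)=1\otimes 1\otimes 1 .$$ The twist $H^F$ is the algebra $H$ with counit $\varepsilon$ and comultiplication $\Delta_F(h)=F\Delta(h)F^{-1}$. A Hopf algebra $H'$ over $\Bbbk$ is gauge equivalent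 to $H$ if $H'\cong H^F$ as bialgebras for some 2-cocycle $F$ of $H$. (1) The sequence $(\nu_n(H))_{n\ge 1}$ is invariant under gauge equivalence: if $H'$ is a Hopf algebra over $\Bbbk$ that is gauge equivalent to $H$, then $\nu_n(H')=\nu_n(H)$ for all positive integers $n$. (2) Let $\lambda\in H^*$ be a right integral of $H^*$ (that is, $\lambda f=f(1)\lambda$ for all $f\in H^*$, where $H^*$ carries the convolution product) and let $\Lambda\in H$ be a left integral of $H$ (that is, $h\Lambda=\varepsilon(h)\Lambda$ for all $h\in H$). If $\lambda(\Lambda)=1$, then for all positive integers $n$ $$\nu_n(H)=\lambda(S(\Lambda^{[n]})).$$ -/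

import Mathlib

open scoped TensorProduct

universe u v w

namespace HopfIndicator

noncomputable section

section SweedlerPower

variable (k : Type u) (H : Type v) [Field k] [Ring H] [HopfAlgebra k H]

/-- The canonical map `H ⊗ H^{⊗ n} → H^{⊗ (n+1)}`, `h ⊗ (h₁ ⊗ ⋯ ⊗ hₙ) ↦ h ⊗ h₁ ⊗ ⋯ ⊗ hₙ`. -/
def consTensor (n : ℕ) : H ⊗[k] (⨂[k]^n H) →ₗ[k] ⨂[k]^(n + 1) H :=
  TensorProduct.lift
    ((PiTensorProduct.lift (R := k) (s := fun _ : Fin n => H)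
        (E := ⨂[k]^(n + 1) H)).toLinearMap ∘ₗ
      (PiTensorProduct.tprod k (s := fun _ : Fin (n + 1) => H)).curryLeft)

/-- `iterComul k H n` is the iterated comultiplication `Δ^{(n+1)} : H → H^{⊗ (n+1)}`:
`Δ^{(1)} = id` and `Δ^{(n+1)} = (id ⊗ Δ^{(n)}) ∘ Δ` for `n ≥ 1`. -/
def iterComul : (n : ℕ) → H →ₗ[k] ⨂[k]^(n + 1) H
  | 0 => (PiTensorProduct.subsingletonEquiv (R := k) (s := fun _ : Fin 1 => H) 0).symm.toLinearMap
  | n + 1 => consTensor k H (n + 1) ∘ₗ (iterComul n).lTensor H ∘ₗ Coalgebra.comul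

/-- The multiplication map `m^{(n)} : H^{⊗ n} → H`, `h₁ ⊗ ⋯ ⊗ hₙ ↦ h₁ ⋯ hₙ`. -/
def iterMul (n : ℕ) : ⨂[k]^n H →ₗ[k] H :=
  PiTensorProduct.lift (MultilinearMap.mkPiAlgebraFin k n H)

/-- The `n`-th Sweedler power map `P_n : h ↦ h^{[n]}`:
`P_0 = ε(·) 1` and `P_n = m^{(n)} ∘ Δ^{(n)}` for `n ≥ 1`. -/
def sweedlerPower : ℕ → H →ₗ[k] H
  | 0 => Algebra.linearMap k H ∘ₗ Coalgebra.counit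
  | n + 1 => iterMul k H (n + 1) ∘ₗ iterComul k H n

/-- The `n`-th indicator `ν_n(H) = Tr(S ∘ P_{n-1})`, meaningful for `n ≥ 1`. -/
def indicator (n : ℕ) : k :=
  LinearMap.trace k H (HopfAlgebra.antipode k ∘ₗ sweedlerPower k H (n - 1))

end SweedlerPower

section Integrals

variable (k : Type u) {H : Type v} [Field k] [Ring H] [HopfAlgebra k H]

/-- `Λ ∈ H` is a left integral of `H`: `h Λ = ε(h) Λ` for all `h ∈ H`. -/
def IsLeftIntegral (Λ : H) : Prop :=
  ∀ h : H, h * Λ = Coalgebra.counit (R := k) h • Λ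

/-- `l ∈ H*` is a right integral of `H*`: `l * f = f(1) l` for all `f ∈ H*`, where `*` is the
convolution product of the dual algebra `H*`, whose augmentation is evaluation at `1`. -/
def IsRightIntegralDual (l : H →ₗ[k] k) : Prop :=
  ∀ f : H →ₗ[k] k, WithConv.toConv l * WithConv.toConv f = f 1 • WithConv.toConv l

end Integrals

section Twist

variable (k : Type u) (H : Type v) [Field k] [Ring H] [HopfAlgebra k H]

/-- A 2-cocycle of `H`: an invertible `F ∈ H ⊗ H` with `(ε ⊗ id)(F) = (id ⊗ ε)(F) = 1` and
`(1 ⊗ F) (id ⊗ Δ)(F) (Δ ⊗ id)(F⁻¹) (F⁻¹ ⊗ 1) = 1`, the last equation in `H ⊗ (H ⊗ H)`. -/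
structure TwoCocycle where
  F : (H ⊗[k] H)ˣ
  counit_left : TensorProduct.lid k H (Coalgebra.counit.rTensor H (F : H ⊗[k] H)) = 1
  counit_right : TensorProduct.rid k H (Coalgebra.counit.lTensor H (F : H ⊗[k] H)) = 1
  cocycle :
    ((1 : H) ⊗ₜ[k] (F : H ⊗[k] H)) *
      Coalgebra.comul.lTensor H (F : H ⊗[k] H) *
      TensorProduct.assoc k H H H
        (Coalgebra.comul.rTensor H ((F⁻¹ : (H ⊗[k] H)ˣ) : H ⊗[k] H)) *
      TensorProduct.assoc k H H H (((F⁻¹ : (H ⊗[k] H)ˣ) : H ⊗[k] H) ⊗ₜ[k] (1 : H)) = 1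

variable {k H}

/-- The twisted comultiplication `Δ_F(h) = F Δ(h) F⁻¹`, as an algebra homomorphism. -/
def twistComul (c : TwoCocycle k H) : H →ₐ[k] H ⊗[k] H :=
  AlgHom.ofLinearMap
    (LinearMap.mulLeft k (c.F : H ⊗[k] H) ∘ₗ
      LinearMap.mulRight k ((c.F⁻¹ : (H ⊗[k] H)ˣ) : H ⊗[k] H) ∘ₗ Coalgebra.comul)
    (by simp)
    (by intro x y; simp [mul_assoc])

theorem twistComul_apply (c : TwoCocycle k H) (h : H) :
    twistComul c h = (c.F : H ⊗[k] H) * Coalgebra.comul h *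
      ((c.F⁻¹ : (H ⊗[k] H)ˣ) : H ⊗[k] H) := by
  simp [twistComul, mul_assoc]

theorem map_inv_eq_one {A B : Type*} [Ring A] [Ring B] (f : A →* B) (x : Aˣ)
    (h : f x = 1) : f ((x⁻¹ : Aˣ) : A) = 1 := by
  have := f.map_mul (x : A) ((x⁻¹ : Aˣ) : A)
  rw [Units.mul_inv, map_one, h, one_mul] at this
  exact this.symm

theorem twistComul_rTensor (c : TwoCocycle k H) :
    (Algebra.TensorProduct.map (Bialgebra.counitAlgHom k H) (AlgHom.id k H)).comp
      (twistComul c) = (Algebra.TensorProduct.lid k H).symm := by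
  ext h
  set g := Algebra.TensorProduct.map (Bialgebra.counitAlgHom k H) (AlgHom.id k H) with hg
  have hF : g c.F = 1 := by
    apply (Algebra.TensorProduct.lid k H).injective
    rw [map_one]
    exact c.counit_left
  have hF' : g ((c.F⁻¹ : (H ⊗[k] H)ˣ) : H ⊗[k] H) = 1 :=
    map_inv_eq_one (g : H ⊗[k] H →* k ⊗[k] H) c.F hF
  have hD : g (Coalgebra.comul h) = 1 ⊗ₜ h := Coalgebra.rTensor_counit_comul h
  simp [twistComul_apply, hF, hF', hD]

theorem twistComul_lTensor (c : TwoCocycle k H) :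
    (Algebra.TensorProduct.map (AlgHom.id k H) (Bialgebra.counitAlgHom k H)).comp
      (twistComul c) = (Algebra.TensorProduct.rid k k H).symm := by
  ext h
  set g := Algebra.TensorProduct.map (AlgHom.id k H) (Bialgebra.counitAlgHom k H) with hg
  have hF : g c.F = 1 := by
    apply (Algebra.TensorProduct.rid k k H).injective
    rw [map_one]
    exact c.counit_right
  have hF' : g ((c.F⁻¹ : (H ⊗[k] H)ˣ) : H ⊗[k] H) = 1 :=
    map_inv_eq_one (g : H ⊗[k] H →* H ⊗[k] k) c.F hF
  have hD : g (Coalgebra.comul h) = h ⊗ₜ 1 := Coalgebra.lTensor_counit_comul h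
  simp [twistComul_apply, hF, hF', hD]

theorem map_twistComul_id (c : TwoCocycle k H) (x : H ⊗[k] H) :
    Algebra.TensorProduct.map (twistComul c) (AlgHom.id k H) x =
      ((c.F : H ⊗[k] H) ⊗ₜ[k] (1 : H)) * Coalgebra.comul.rTensor H x *
        (((c.F⁻¹ : (H ⊗[k] H)ˣ) : H ⊗[k] H) ⊗ₜ[k] (1 : H)) := by
  induction x with
  | zero => simp
  | tmul a b => simp [twistComul_apply]
  | add a b ha hb => simp [ha, hb, mul_add, add_mul]

theorem map_id_twistComul (c : TwoCocycle k H) (x : H ⊗[k] H) :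
    Algebra.TensorProduct.map (AlgHom.id k H) (twistComul c) x =
      ((1 : H) ⊗ₜ[k] (c.F : H ⊗[k] H)) * Coalgebra.comul.lTensor H x *
        ((1 : H) ⊗ₜ[k] ((c.F⁻¹ : (H ⊗[k] H)ˣ) : H ⊗[k] H)) := by
  induction x with
  | zero => simp
  | tmul a b => simp [twistComul_apply]
  | add a b ha hb => simp [ha, hb, mul_add, add_mul]

theorem twistComul_coassoc (c : TwoCocycle k H) :
    (Algebra.TensorProduct.assoc k k k H H H).toAlgHom.comp
      ((Algebra.TensorProduct.map (twistComul c) (AlgHom.id k H)).comp (twistComul c)) =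
      (Algebra.TensorProduct.map (AlgHom.id k H) (twistComul c)).comp (twistComul c) := by
  ext h
  let L := (Algebra.TensorProduct.assoc k k k H H H).toAlgHom.comp
    (Algebra.TensorProduct.map (Bialgebra.comulAlgHom k H) (AlgHom.id k H))
  let L' := (Algebra.TensorProduct.assoc k k k H H H).toAlgHom.comp
    (Algebra.TensorProduct.includeLeft : H ⊗[k] H →ₐ[k] (H ⊗[k] H) ⊗[k] H)
  let R := Algebra.TensorProduct.map (AlgHom.id k H) (Bialgebra.comulAlgHom k H)
  let R' := (Algebra.TensorProduct.includeRight : H ⊗[k] H →ₐ[k] H ⊗[k] (H ⊗[k] H))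
  let l := Units.map (L : H ⊗[k] H →* H ⊗[k] (H ⊗[k] H)) c.F
  let l' := Units.map (L' : H ⊗[k] H →* H ⊗[k] (H ⊗[k] H)) c.F
  let r := Units.map (R : H ⊗[k] H →* H ⊗[k] (H ⊗[k] H)) c.F
  let r' := Units.map (R' : H ⊗[k] H →* H ⊗[k] (H ⊗[k] H)) c.F
  have hc : r' * r * l⁻¹ * l'⁻¹ = 1 := Units.ext c.cocycle
  have h1 : r' * r = l' * l := by
    rw [← mul_inv_eq_one, mul_inv_rev, ← mul_assoc]; exact hc
  have h2 : (r' * r)⁻¹ = (l' * l)⁻¹ := by rw [h1]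
  rw [mul_inv_rev, mul_inv_rev] at h2
  have e1 := congrArg Units.val h1
  have e2 := congrArg Units.val h2
  have hD : L (Coalgebra.comul h) = R (Coalgebra.comul h) := Coalgebra.coassoc_apply h
  have lhs : (Algebra.TensorProduct.assoc k k k H H H).toAlgHom
      (Algebra.TensorProduct.map (twistComul c) (AlgHom.id k H) (twistComul c h)) =
      (l' : H ⊗[k] (H ⊗[k] H)) * l * L (Coalgebra.comul h) *
        ((l⁻¹ : (H ⊗[k] (H ⊗[k] H))ˣ) * (l'⁻¹ : (H ⊗[k] (H ⊗[k] H))ˣ)) := by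
    rw [map_twistComul_id, map_mul, map_mul]
    change L' c.F * L (twistComul c h) * L' ((c.F⁻¹ : (H ⊗[k] H)ˣ) : H ⊗[k] H) = _
    rw [twistComul_apply, map_mul, map_mul]
    change _ = L' c.F * L c.F * L (Coalgebra.comul h) *
      (L ((c.F⁻¹ : (H ⊗[k] H)ˣ) : H ⊗[k] H) * L' ((c.F⁻¹ : (H ⊗[k] H)ˣ) : H ⊗[k] H))
    simp only [mul_assoc]
  have rhs : Algebra.TensorProduct.map (AlgHom.id k H) (twistComul c) (twistComul c h) =
      (r' : H ⊗[k] (H ⊗[k] H)) * r * R (Coalgebra.comul h) *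
        ((r⁻¹ : (H ⊗[k] (H ⊗[k] H))ˣ) * (r'⁻¹ : (H ⊗[k] (H ⊗[k] H))ˣ)) := by
    rw [map_id_twistComul]
    change R' c.F * R (twistComul c h) * R' ((c.F⁻¹ : (H ⊗[k] H)ˣ) : H ⊗[k] H) = _
    rw [twistComul_apply, map_mul, map_mul]
    change _ = R' c.F * R c.F * R (Coalgebra.comul h) *
      (R ((c.F⁻¹ : (H ⊗[k] H)ˣ) : H ⊗[k] H) * R' ((c.F⁻¹ : (H ⊗[k] H)ˣ) : H ⊗[k] H))
    simp only [mul_assoc]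
  change (Algebra.TensorProduct.assoc k k k H H H).toAlgHom
      (Algebra.TensorProduct.map (twistComul c) (AlgHom.id k H) (twistComul c h)) =
    Algebra.TensorProduct.map (AlgHom.id k H) (twistComul c) (twistComul c h)
  rw [lhs, rhs, hD]
  simp only [Units.val_mul] at e1 e2
  rw [e1, e2]

/-- The underlying algebra of the twist `H^F`, which is `H` itself. -/
def Twist (_c : TwoCocycle k H) : Type v := H

instance (c : TwoCocycle k H) : Ring (Twist c) := inferInstanceAs (Ring H)

/-- The twist `H^F`: the algebra `H` with its counit `ε` and the comultiplication `Δ_F`. -/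
instance (c : TwoCocycle k H) : Bialgebra k (Twist c) :=
  letI : Algebra k (Twist c) := inferInstanceAs (Algebra k H)
  Bialgebra.ofAlgHom (A := Twist c) (twistComul (k := k) (H := H) c)
    (Bialgebra.counitAlgHom k H) (twistComul_coassoc (k := k) (H := H) c)
    (twistComul_rTensor (k := k) (H := H) c) (twistComul_lTensor (k := k) (H := H) c)

end Twist

/-- `H'` is gauge equivalent to `H`: for some 2-cocycle `F` of `H`, the bialgebras `H'` and `H^F`
are isomorphic. -/
def GaugeEquivalent (k : Type u) (H : Type v) (H' : Type w) [Field k] [Ring H] [HopfAlgebra k H]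
    [Ring H'] [HopfAlgebra k H'] : Prop :=
  ∃ c : TwoCocycle k H, Nonempty (H' ≃ₐc[k] Twist c)

end

end HopfIndicator

namespace HopfIndicator

noncomputable section

section TensorPower

variable (k : Type u) (H : Type v) [Field k] [Ring H] [HopfAlgebra k H]

theorem consTensor_tmul_tprod (n : ℕ) (h : H) (x : Fin n → H) :
    consTensor k H n (h ⊗ₜ PiTensorProduct.tprod k x) =
      PiTensorProduct.tprod k (Fin.cons h x : Fin (n + 1) → H) := by
  simp [consTensor]

/-- `consTensor` as an algebra homomorphism. -/
def consAlgHom (n : ℕ) : H ⊗[k] (⨂[k]^n H) →ₐ[k] ⨂[k]^(n + 1) H :=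
  AlgHom.ofLinearMap (consTensor k H n)
    (by
      rw [Algebra.TensorProduct.one_def, PiTensorProduct.one_def, consTensor_tmul_tprod]
      congr 1
      ext i
      refine Fin.cases ?_ (fun _ => ?_) i <;> simp)
    (by
      rw [LinearMap.map_mul_iff]
      ext h x h' x'
      simp [consTensor_tmul_tprod]
      congr 1
      ext i
      refine Fin.cases ?_ (fun _ => ?_) i <;> simp)

/-- The canonical isomorphism `H^{⊗ n} ⊗ H ≃ H^{⊗ (n+1)}`. -/
def snocEquiv (n : ℕ) : (⨂[k]^n H) ⊗[k] H ≃ₗ[k] ⨂[k]^(n + 1) H :=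
  (TensorProduct.congr (LinearEquiv.refl k _)
    (PiTensorProduct.subsingletonEquiv (R := k) (s := fun _ : Fin 1 => H) 0).symm).trans
    TensorPower.mulEquiv

theorem snocEquiv_tprod_tmul (n : ℕ) (x : Fin n → H) (h : H) :
    snocEquiv k H n (PiTensorProduct.tprod k x ⊗ₜ h) =
      PiTensorProduct.tprod k (Fin.snoc x h : Fin (n + 1) → H) := by
  have := TensorPower.tprod_mul_tprod k x (fun _ : Fin 1 => h)
  simp only [snocEquiv, LinearEquiv.trans_apply, TensorProduct.congr_tmul, LinearEquiv.refl_apply]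
  rw [TensorPower.gMul_def] at this
  have h2 : (PiTensorProduct.subsingletonEquiv (R := k) (s := fun _ : Fin 1 => H) 0).symm h = PiTensorProduct.tprod k (fun _ : Fin 1 => h) := by
    rw [LinearEquiv.symm_apply_eq]; simp
  rw [h2]
  erw [this]
  rw [Fin.append_right_eq_snoc]

/-- `snocEquiv` as an algebra isomorphism. -/
def snocAlgEquiv (n : ℕ) : (⨂[k]^n H) ⊗[k] H ≃ₐ[k] ⨂[k]^(n + 1) H :=
  AlgEquiv.ofLinearEquiv (snocEquiv k H n)
    (by
      rw [Algebra.TensorProduct.one_def, PiTensorProduct.one_def, snocEquiv_tprod_tmul]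
      congr 1
      ext i
      refine Fin.lastCases ?_ (fun _ => ?_) i <;> simp)
    (by
      refine (LinearMap.map_mul_iff (snocEquiv k H n).toLinearMap).mpr ?_
      ext h x h' x'
      simp [snocEquiv_tprod_tmul]
      congr 1
      ext i
      refine Fin.lastCases ?_ (fun _ => ?_) i <;> simp)


variable {k H}

@[simp]
theorem consAlgHom_tmul_tprod (n : ℕ) (h : H) (x : Fin n → H) :
    consAlgHom k H n (h ⊗ₜ PiTensorProduct.tprod k x) =
      PiTensorProduct.tprod k (Fin.cons h x : Fin (n + 1) → H) :=
  consTensor_tmul_tprod k H n h x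

@[simp]
theorem snocAlgEquiv_tprod_tmul (n : ℕ) (x : Fin n → H) (h : H) :
    snocAlgEquiv k H n (PiTensorProduct.tprod k x ⊗ₜ h) =
      PiTensorProduct.tprod k (Fin.snoc x h : Fin (n + 1) → H) :=
  snocEquiv_tprod_tmul k H n x h

theorem tensorPower_induction {n : ℕ} {p : (⨂[k]^n H) → Prop}
    (tprod : ∀ x : Fin n → H, p (PiTensorProduct.tprod k x))
    (smul : ∀ (r : k) t, p t → p (r • t)) (add : ∀ s t, p s → p t → p (s + t))
    (t : ⨂[k]^n H) : p t := by
  induction t using PiTensorProduct.induction_on with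
  | smul_tprod r x => exact smul r _ (tprod x)
  | add s t hs ht => exact add s t hs ht

theorem consAlgHom_snocAlgEquiv (n : ℕ) (h : H) (t : ⨂[k]^n H) (y : H) :
    consAlgHom k H (n + 1) (h ⊗ₜ snocAlgEquiv k H n (t ⊗ₜ y)) =
      snocAlgEquiv k H (n + 1) (consAlgHom k H n (h ⊗ₜ t) ⊗ₜ y) := by
  induction t using tensorPower_induction with
  | tprod x => simp [Fin.cons_snoc_eq_snoc_cons]
  | smul r t ht => simp only [← TensorProduct.smul_tmul', TensorProduct.tmul_smul, map_smul, ht]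
  | add s t hs ht => simp only [TensorProduct.add_tmul, TensorProduct.tmul_add, map_add, hs, ht]

theorem iterMul_consAlgHom (n : ℕ) (h : H) (t : ⨂[k]^n H) :
    iterMul k H (n + 1) (consAlgHom k H n (h ⊗ₜ t)) = h * iterMul k H n t := by
  induction t using tensorPower_induction with
  | tprod x => simp [iterMul, List.ofFn_succ]
  | smul r t ht => simp only [TensorProduct.tmul_smul, map_smul, ht, mul_smul_comm]
  | add s t hs ht => simp only [TensorProduct.tmul_add, map_add, hs, ht, mul_add]

theorem iterMul_one (n : ℕ) : iterMul k H n 1 = 1 := by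
  have : (List.ofFn (1 : Fin n → H)).prod = 1 := by
    rw [Pi.one_def, List.ofFn_const, List.prod_replicate, one_pow]
  rw [PiTensorProduct.one_def]
  simpa [iterMul] using this

theorem prod_ofFn_mul_snoc (n : ℕ) (x : Fin (n + 1) → H) (b : Fin n → H) (y : H) :
    (List.ofFn (x * (Fin.snoc b y : Fin (n + 1) → H))).prod =
      (List.ofFn ((Fin.cons 1 b : Fin (n + 1) → H) * x)).prod * y := by
  induction n with
  | zero => simp [Fin.snoc]
  | succ n ih =>
    have h1 := ih (fun i => x i.succ) (fun i => b i.succ)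
    rw [List.ofFn_succ, List.prod_cons]
    conv_rhs => rw [List.ofFn_succ, List.prod_cons]
    have e1 : (fun i : Fin (n + 1) => (x * (Fin.snoc b y : Fin (n + 2) → H)) i.succ) =
        (fun i => x i.succ) * (Fin.snoc (fun i => b i.succ) y : Fin (n + 1) → H) := by
      ext i
      refine Fin.lastCases ?_ (fun j => ?_) i
      · simp [Fin.succ_last]
      · simp [Fin.succ_castSucc, -Fin.castSucc_succ]
    rw [e1, h1]
    conv_lhs => rw [List.ofFn_succ, List.prod_cons]
    conv_rhs => rw [List.ofFn_succ, List.prod_cons]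
    have : (Fin.snoc b y : Fin (n + 2) → H) 0 = b 0 := by
      rw [← Fin.castSucc_zero, Fin.snoc_castSucc]
    have e2 : ∀ j : Fin n, (Fin.cons 1 b : Fin (n + 2) → H) j.succ.succ = b j.succ := fun j => rfl
    simp [this, e2, mul_assoc]

theorem iterMul_mul_snocAlgEquiv (n : ℕ) (s : ⨂[k]^(n + 1) H) (t : ⨂[k]^n H) (y : H) :
    iterMul k H (n + 1) (s * snocAlgEquiv k H n (t ⊗ₜ y)) =
      iterMul k H (n + 1) (consAlgHom k H n (1 ⊗ₜ t) * s) * y := by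
  induction t using tensorPower_induction with
  | tprod b =>
    induction s using tensorPower_induction with
    | tprod x =>
      simp only [snocAlgEquiv_tprod_tmul, consAlgHom_tmul_tprod, PiTensorProduct.tprod_mul_tprod]
      simpa [iterMul] using prod_ofFn_mul_snoc n x b y
    | smul r s hs => simp only [smul_mul_assoc, mul_smul_comm, map_smul, hs]
    | add s t hs ht => simp only [add_mul, mul_add, map_add, hs, ht]
  | smul r t ht => simp only [← TensorProduct.smul_tmul', TensorProduct.tmul_smul, map_smul, ht,
      smul_mul_assoc, mul_smul_comm]
  | add s t hs ht => simp only [TensorProduct.add_tmul, TensorProduct.tmul_add, map_add, hs, ht,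
      add_mul, mul_add]

theorem iterMul_consAlgHom_mul (n : ℕ) (s : ⨂[k]^(n + 1) H) (h : H) :
    iterMul k H (n + 1) (consAlgHom k H n (h ⊗ₜ 1) * s) = h * iterMul k H (n + 1) s := by
  induction s using tensorPower_induction with
  | tprod x =>
    rw [PiTensorProduct.one_def]
    simp only [consAlgHom_tmul_tprod, PiTensorProduct.tprod_mul_tprod]
    simp [iterMul, List.ofFn_succ, mul_assoc]
  | smul r s hs => simp only [mul_smul_comm, map_smul, hs]
  | add s t hs ht => simp only [mul_add, map_add, hs, ht]

variable (k H) in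
/-- The iterated comultiplication `Δ⁽ⁿ⁾ : H → H^{⊗ n}` as an algebra homomorphism, with
`Δ⁽⁰⁾ = ε`. -/
def comulPow : (n : ℕ) → H →ₐ[k] ⨂[k]^n H
  | 0 => (Algebra.ofId k _).comp (Bialgebra.counitAlgHom k H)
  | n + 1 => (consAlgHom k H n).comp
      ((Algebra.TensorProduct.map (AlgHom.id k H) (comulPow n)).comp (Bialgebra.comulAlgHom k H))

variable (k H) in
/-- The algebra homomorphism `id ⊗ Δ⁽ⁿ⁾ : H ⊗ H → H^{⊗ (n+1)}`. -/
def comulPowRight (n : ℕ) : H ⊗[k] H →ₐ[k] ⨂[k]^(n + 1) H :=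
  (consAlgHom k H n).comp (Algebra.TensorProduct.map (AlgHom.id k H) (comulPow k H n))

variable (k H) in
/-- The algebra homomorphism `Δ⁽ⁿ⁾ ⊗ id : H ⊗ H → H^{⊗ (n+1)}`. -/
def comulPowLeft (n : ℕ) : H ⊗[k] H →ₐ[k] ⨂[k]^(n + 1) H :=
  (snocAlgEquiv k H n : (⨂[k]^n H) ⊗[k] H →ₐ[k] ⨂[k]^(n + 1) H).comp (Algebra.TensorProduct.map (comulPow k H n) (AlgHom.id k H))

@[simp]
theorem comulPowRight_tmul (n : ℕ) (x y : H) :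
    comulPowRight k H n (x ⊗ₜ y) = consAlgHom k H n (x ⊗ₜ comulPow k H n y) := rfl

@[simp]
theorem comulPowLeft_tmul (n : ℕ) (x y : H) :
    comulPowLeft k H n (x ⊗ₜ y) = snocAlgEquiv k H n (comulPow k H n x ⊗ₜ y) := rfl

theorem comulPowRight_comul (n : ℕ) (h : H) :
    comulPowRight k H n (Coalgebra.comul h) = comulPow k H (n + 1) h := rfl

variable (k H) in
/-- The algebra homomorphism `id ⊗ Δ⁽ⁿ⁾ ⊗ id : H ⊗ H ⊗ H → H^{⊗ (n+2)}`. -/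
def comulPowMiddle (n : ℕ) : H ⊗[k] (H ⊗[k] H) →ₐ[k] ⨂[k]^(n + 2) H :=
  (consAlgHom k H (n + 1)).comp
    (Algebra.TensorProduct.map (AlgHom.id k H) (comulPowLeft k H n))

theorem comulPowMiddle_includeRight (n : ℕ) (x : H ⊗[k] H) :
    comulPowMiddle k H n (1 ⊗ₜ x) = consAlgHom k H (n + 1) (1 ⊗ₜ comulPowLeft k H n x) := rfl

theorem comulPowMiddle_includeLeft (n : ℕ) (x : H ⊗[k] H) :
    comulPowMiddle k H n (TensorProduct.assoc k H H H (x ⊗ₜ 1)) =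
      snocAlgEquiv k H (n + 1) (comulPowRight k H n x ⊗ₜ 1) := by
  induction x with
  | zero => simp
  | tmul a b => simp [comulPowMiddle, consAlgHom_snocAlgEquiv]
  | add x y hx hy => simp only [TensorProduct.add_tmul, map_add, hx, hy]

theorem comulPowMiddle_rTensor (n : ℕ) (x : H ⊗[k] H) :
    comulPowMiddle k H n (TensorProduct.assoc k H H H (Coalgebra.comul.rTensor H x)) =
      comulPowLeft k H (n + 1) x := by
  induction x with
  | zero => simp
  | tmul a b =>
    rw [LinearMap.rTensor_tmul, comulPowLeft_tmul, ← comulPowRight_comul]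
    generalize (Coalgebra.comul a : H ⊗[k] H) = z
    induction z with
    | zero => simp
    | tmul x y => simp [comulPowMiddle, consAlgHom_snocAlgEquiv]
    | add x y hx hy => simp only [TensorProduct.add_tmul, map_add, hx, hy]
  | add x y hx hy => simp only [map_add, hx, hy]

theorem comulPowLeft_comul (n : ℕ) (h : H) :
    comulPowLeft k H n (Coalgebra.comul h) = comulPow k H (n + 1) h := by
  induction n generalizing h with
  | zero =>
    rw [← comulPowRight_comul]
    have h1 : comulPowRight k H 0 (Coalgebra.comul h) =
        consAlgHom k H 0 (Algebra.TensorProduct.map (AlgHom.id k H) (Algebra.ofId k _)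
          (Coalgebra.counit.lTensor H (Coalgebra.comul h))) := by
      generalize (Coalgebra.comul h : H ⊗[k] H) = z
      induction z with
      | zero => simp
      | tmul x y => rfl
      | add x y hx hy => simp only [map_add, hx, hy]
    have h2 : comulPowLeft k H 0 (Coalgebra.comul h) =
        snocAlgEquiv k H 0 (Algebra.TensorProduct.map (Algebra.ofId k _) (AlgHom.id k H)
          (Coalgebra.counit.rTensor H (Coalgebra.comul h))) := by
      generalize (Coalgebra.comul h : H ⊗[k] H) = z
      induction z with
      | zero => simp
      | tmul x y => rfl
      | add x y hx hy => simp only [map_add, hx, hy]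
    rw [h1, h2]
    rw [Coalgebra.rTensor_counit_comul, Coalgebra.lTensor_counit_comul]
    simp only [Algebra.TensorProduct.map_tmul, map_one, PiTensorProduct.one_def, AlgHom.id_apply,
      consAlgHom_tmul_tprod, snocAlgEquiv_tprod_tmul]
    congr 1
    ext i
    fin_cases i
    rfl
  | succ n ih =>
    rw [← comulPowMiddle_rTensor, Coalgebra.coassoc_apply, ← comulPowRight_comul]
    generalize (Coalgebra.comul h : H ⊗[k] H) = z
    induction z with
    | zero => simp
    | tmul x y => simp [comulPowMiddle, ih]
    | add x y hx hy => simp only [map_add, hx, hy]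

theorem comulPowMiddle_lTensor (n : ℕ) (x : H ⊗[k] H) :
    comulPowMiddle k H n (Coalgebra.comul.lTensor H x) = comulPowRight k H (n + 1) x := by
  induction x with
  | zero => simp
  | tmul a b => simp [comulPowMiddle, comulPowLeft_comul]
  | add x y hx hy => simp only [map_add, hx, hy]

/-- The Sweedler power `P_n` is the `n`-th convolution power of the identity. -/
theorem toConv_sweedlerPower (n : ℕ) :
    WithConv.toConv (sweedlerPower k H n) = WithConv.toConv (LinearMap.id : H →ₗ[k] H) ^ n := by
  induction n with
  | zero => rfl
  | succ n ih =>
    cases n with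
    | zero =>
      rw [zero_add, pow_one]
      congr 1
      ext h
      have h2 : (PiTensorProduct.subsingletonEquiv (R := k) (s := fun _ : Fin 1 => H) 0).symm h =
          PiTensorProduct.tprod k (fun _ : Fin 1 => h) := by
        rw [LinearEquiv.symm_apply_eq]; simp
      simp [sweedlerPower, iterComul, h2, iterMul]
    | succ n =>
      rw [pow_succ', ← ih, LinearMap.convMul_def]
      congr 1
      ext h
      simp only [sweedlerPower, iterComul, LinearMap.comp_apply]
      generalize (Coalgebra.comul h : H ⊗[k] H) = z
      induction z with
      | zero => simp
      | tmul x y => exact iterMul_consAlgHom (n + 1) x _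
      | add x y hx hy => simp only [map_add, hx, hy]

theorem sweedlerPower_eq_iterMul_comulPow (n : ℕ) (h : H) :
    sweedlerPower k H n h = iterMul k H n (comulPow k H n h) := by
  induction n generalizing h with
  | zero =>
    simp [sweedlerPower, comulPow, Algebra.ofId_apply, Algebra.algebraMap_eq_smul_one, iterMul_one]
  | succ n ih =>
    have := congr(($(toConv_sweedlerPower (k := k) (H := H) (n + 1))).ofConv h)
    rw [pow_succ', ← toConv_sweedlerPower, LinearMap.convMul_def] at this
    simp only [LinearMap.comp_apply] at this
    rw [this, ← comulPowRight_comul]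
    generalize (Coalgebra.comul h : H ⊗[k] H) = z
    induction z with
    | zero => simp
    | tmul x y => simp [ih, iterMul_consAlgHom]
    | add x y hx hy => simp only [map_add, hx, hy]

end TensorPower

section Radford

variable {k : Type u} {H : Type v} [Field k] [Ring H] [HopfAlgebra k H]

theorem lTensor_mulLeft_comul_of_isLeftIntegral {Λ : H} (hΛ : IsLeftIntegral k Λ) (h : H) :
    ((1 : H) ⊗ₜ[k] h) * Coalgebra.comul Λ =
      (HopfAlgebra.antipode k h ⊗ₜ[k] (1 : H)) * Coalgebra.comul Λ := by
  let Ψ : H ⊗[k] (H ⊗[k] H) →ₗ[k] H ⊗[k] H :=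
    LinearMap.mulRight k (Coalgebra.comul Λ) ∘ₗ
    LinearMap.mul' k (H ⊗[k] H) ∘ₗ
      TensorProduct.map
        ((Algebra.TensorProduct.includeLeft : H →ₐ[k] H ⊗[k] H).toLinearMap ∘ₗ
          HopfAlgebra.antipode k) LinearMap.id
  have h1 : Ψ (Coalgebra.comul.lTensor H (Coalgebra.comul h)) =
      (HopfAlgebra.antipode k h ⊗ₜ[k] (1 : H)) * Coalgebra.comul Λ := by
    have : Ψ ∘ₗ Coalgebra.comul.lTensor H =
        (LinearMap.mulRight k (Coalgebra.comul Λ) ∘ₗ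
        (Algebra.TensorProduct.includeLeft : H →ₐ[k] H ⊗[k] H).toLinearMap ∘ₗ
          HopfAlgebra.antipode k ∘ₗ (TensorProduct.rid k H).toLinearMap) ∘ₗ
          Coalgebra.counit.lTensor H := by
      ext x y
      have : Coalgebra.comul y * Coalgebra.comul Λ =
          Coalgebra.counit (R := k) y • (Coalgebra.comul Λ : H ⊗[k] H) := by
        rw [← Bialgebra.comul_mul, hΛ, map_smul]
      simp [Ψ, mul_assoc, this]
    have := congr($this (Coalgebra.comul h))
    simpa using this
  have h2 : Ψ (TensorProduct.assoc k H H H (Coalgebra.comul.rTensor H (Coalgebra.comul h))) =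
      ((1 : H) ⊗ₜ[k] h) * Coalgebra.comul Λ := by
    have : Ψ ∘ₗ (TensorProduct.assoc k H H H).toLinearMap =
        LinearMap.mulRight k (Coalgebra.comul Λ) ∘ₗ
          (LinearMap.mul' k H ∘ₗ (HopfAlgebra.antipode k).rTensor H).rTensor H := by
      ext x y z
      simp [Ψ]
    have h3 := congr($this (Coalgebra.comul.rTensor H (Coalgebra.comul h)))
    have h4 : (LinearMap.mul' k H ∘ₗ (HopfAlgebra.antipode k).rTensor H).rTensor H
        (Coalgebra.comul.rTensor H (Coalgebra.comul h)) = (1 : H) ⊗ₜ[k] h := by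
      rw [← LinearMap.comp_apply, ← LinearMap.rTensor_comp, LinearMap.comp_assoc,
        HopfAlgebra.mul_antipode_rTensor_comul, LinearMap.rTensor_comp, LinearMap.comp_apply,
        Coalgebra.rTensor_counit_comul]
      simp
    simpa [h4] using h3
  rw [← h1, ← h2, Coalgebra.coassoc_apply]

theorem sum_smul_eq_of_isRightIntegralDual {l : H →ₗ[k] k} (hl : IsRightIntegralDual k l) {ι : Type*}
    {x : H} (r : Coalgebra.Repr k x ι) : ∑ i ∈ r.index, l (r.left i) • r.right i = l x • (1 : H) := by
  rw [← sub_eq_zero, ← Module.forall_dual_apply_eq_zero_iff k]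
  intro f
  have := congr($(hl f) x)
  rw [r.convMul_apply] at this
  rw [map_sub, sub_eq_zero]
  simpa [mul_comm] using this

variable [FiniteDimensional k H]

theorem trace_eq_sum_of_isIntegral {l : H →ₗ[k] k} {Λ : H} (hl : IsRightIntegralDual k l)
    (hΛ : IsLeftIntegral k Λ) (h1 : l Λ = 1) {ι : Type*} (r : Coalgebra.Repr k Λ ι)
    (f : H →ₗ[k] H) :
    LinearMap.trace k H f =
      ∑ i ∈ r.index, l (HopfAlgebra.antipode k (r.right i) * f (r.left i)) := by
  have hcas : ∀ h : H, ∑ i ∈ r.index, r.left i ⊗ₜ[k] (h * r.right i) =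
      ∑ i ∈ r.index, (HopfAlgebra.antipode k h * r.left i) ⊗ₜ[k] r.right i := fun h => by
    simpa [← r.eq, Finset.mul_sum] using lTensor_mulLeft_comul_of_isLeftIntegral hΛ h
  have hinv : ∀ h : H, ∑ i ∈ r.index, l (HopfAlgebra.antipode k h * r.left i) • r.right i = h := by
    intro h
    have h2 := congr(TensorProduct.lid k H (l.rTensor H $(hcas h)))
    simp only [map_sum, LinearMap.rTensor_tmul, TensorProduct.lid_tmul] at h2
    rw [← h2]
    simp_rw [← mul_smul_comm, ← Finset.mul_sum]
    rw [sum_smul_eq_of_isRightIntegralDual hl, h1, one_smul, mul_one]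
  have hinj : Function.Injective (HopfAlgebra.antipode k : H →ₗ[k] H) := fun x y hxy => by
    rw [← hinv x, ← hinv y, hxy]
  have hsurj := LinearMap.surjective_of_injective hinj
  have hdual : ∀ x : H, ∑ i ∈ r.index, l (x * r.left i) • HopfAlgebra.antipode k (r.right i) = x := by
    intro x
    obtain ⟨y, rfl⟩ := hsurj x
    conv_rhs => rw [← hinv y]
    simp
  let β : H →ₗ[k] Module.Dual k H := (LinearMap.mul k H).compr₂ l
  let γ : Module.Dual k H →ₗ[k] H :=
    ∑ i ∈ r.index, (LinearMap.applyₗ (r.left i)).smulRight (HopfAlgebra.antipode k (r.right i))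
  have hγβ : γ ∘ₗ β = LinearMap.id := by
    ext x
    simpa [γ, β] using hdual x
  have hβsurj : Function.Surjective β :=
    (LinearMap.injective_iff_surjective_of_finrank_eq_finrank
      (Subspace.dual_finrank_eq (K := k) (V := H)).symm).1
      (LinearMap.injective_of_comp_eq_id _ _ hγβ)
  have hβγ : β ∘ₗ γ = LinearMap.id := by
    rw [LinearMap.ext_iff]
    intro φ
    obtain ⟨x, rfl⟩ := hβsurj φ
    exact congr(β ($hγβ x))
  have hdual' : ∀ y : H, ∑ i ∈ r.index, l (HopfAlgebra.antipode k (r.right i) * y) • r.left i = y := by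
    intro y
    rw [← sub_eq_zero, ← Module.forall_dual_apply_eq_zero_iff k]
    intro φ
    have := congr($hβγ φ y)
    rw [map_sub, sub_eq_zero]
    simpa [γ, β, mul_comm] using this
  have hf : f = ∑ i ∈ r.index, 
      (l ∘ₗ LinearMap.mulLeft k (HopfAlgebra.antipode k (r.right i))).smulRight (f (r.left i)) := by
    ext y
    conv_lhs => rw [← hdual' y]
    simp
  conv_lhs => rw [hf]
  simp [LinearMap.trace_smulRight]

theorem indicator_eq_integral {l : H →ₗ[k] k} {Λ : H} (hl : IsRightIntegralDual k l)
    (hΛ : IsLeftIntegral k Λ) (h1 : l Λ = 1) {n : ℕ} (hn : 1 ≤ n) :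
    indicator k H n = l (HopfAlgebra.antipode k (sweedlerPower k H n Λ)) := by
  obtain ⟨n, rfl⟩ := Nat.exists_eq_add_of_le' hn
  let r := Coalgebra.Repr.arbitrary k Λ
  have h2 := congr(($(toConv_sweedlerPower (k := k) (H := H) (n + 1))) Λ)
  rw [pow_succ, ← toConv_sweedlerPower, r.convMul_apply] at h2
  rw [indicator, trace_eq_sum_of_isIntegral hl hΛ h1 r]
  change sweedlerPower k H (n + 1) Λ = _ at h2
  rw [h2]
  simp [HopfAlgebra.antipode_mul_antidistrib]

end Radford

section TwistTrace

variable {k : Type u} {H : Type v} [Field k] [Ring H] [HopfAlgebra k H]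

theorem trace_mulLeft_comp (x : H) (f : H →ₗ[k] H) :
    LinearMap.trace k H (LinearMap.mulLeft k x ∘ₗ f) =
      LinearMap.trace k H (f ∘ₗ LinearMap.mulLeft k x) :=
  LinearMap.trace_mul_comm k _ f

theorem trace_mulRight_comp (x : H) (f : H →ₗ[k] H) :
    LinearMap.trace k H (LinearMap.mulRight k x ∘ₗ f) =
      LinearMap.trace k H (f ∘ₗ LinearMap.mulRight k x) :=
  LinearMap.trace_mul_comm k _ f

variable (k H) in
/-- `f ⊗ g ↦ f S(g)`. -/
def mulAntipodeRight : H ⊗[k] H →ₗ[k] H :=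
  LinearMap.mul' k H ∘ₗ (HopfAlgebra.antipode k).lTensor H

variable (k H) in
/-- `f ⊗ g ↦ S(f) g`. -/
def mulAntipodeLeft : H ⊗[k] H →ₗ[k] H :=
  LinearMap.mul' k H ∘ₗ (HopfAlgebra.antipode k).rTensor H

@[simp]
theorem mulAntipodeRight_tmul (x y : H) :
    mulAntipodeRight k H (x ⊗ₜ y) = x * HopfAlgebra.antipode k y := rfl

@[simp]
theorem mulAntipodeLeft_tmul (x y : H) :
    mulAntipodeLeft k H (x ⊗ₜ y) = HopfAlgebra.antipode k x * y := rfl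

/-- The map `h ↦ S(m(a Δ⁽ⁿ⁾(h) b))`. -/
def antipodeMulComulPow (n : ℕ) (a b : ⨂[k]^n H) : H →ₗ[k] H :=
  HopfAlgebra.antipode k ∘ₗ iterMul k H n ∘ₗ LinearMap.mulLeft k a ∘ₗ LinearMap.mulRight k b ∘ₗ
    (comulPow k H n).toLinearMap

theorem antipodeMulComulPow_apply (n : ℕ) (a b : ⨂[k]^n H) (h : H) :
    antipodeMulComulPow n a b h =
      HopfAlgebra.antipode k (iterMul k H n (a * comulPow k H n h * b)) := by
  simp [antipodeMulComulPow, mul_assoc]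

variable (k H) in
/-- The linear functional `w ⊗ y ↦ Tr (h ↦ S(m(w Δ⁽ⁿ⁾(S(y) h))))` on `H^{⊗ (n+1)}`. -/
def rotationTrace (n : ℕ) : (⨂[k]^(n + 1) H) →ₗ[k] k :=
  TensorProduct.lift
    (LinearMap.mk₂ k (fun (w : ⨂[k]^n H) (y : H) => LinearMap.trace k H
      (antipodeMulComulPow n w 1 ∘ₗ LinearMap.mulLeft k (HopfAlgebra.antipode k y)))
      (fun w w' y => by
        rw [← map_add]; congr 1; ext h; simp [antipodeMulComulPow_apply, add_mul])
      (fun r w y => by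
        rw [← map_smul]; congr 1; ext h; simp [antipodeMulComulPow_apply])
      (fun w y y' => by
        rw [← map_add]; congr 1; ext h; simp [antipodeMulComulPow_apply, add_mul, mul_add])
      (fun r w y => by
        rw [← map_smul]; congr 1; ext h; simp [antipodeMulComulPow_apply])) ∘ₗ
    (snocAlgEquiv k H n).symm.toLinearMap

theorem rotationTrace_snocAlgEquiv (n : ℕ) (w : ⨂[k]^n H) (y : H) :
    rotationTrace k H n (snocAlgEquiv k H n (w ⊗ₜ y)) = LinearMap.trace k H
      (antipodeMulComulPow n w 1 ∘ₗ LinearMap.mulLeft k (HopfAlgebra.antipode k y)) := by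
  simp [rotationTrace]

theorem trace_antipodeMulComulPow_pure (n : ℕ) (a : ⨂[k]^(n + 1) H) (t : ⨂[k]^n H) (x y d : H) :
    LinearMap.trace k H (LinearMap.mulLeft k x ∘ₗ
      LinearMap.mulRight k (HopfAlgebra.antipode k d) ∘ₗ
        antipodeMulComulPow (n + 1) a (snocAlgEquiv k H n (t ⊗ₜ y))) =
      LinearMap.trace k H (antipodeMulComulPow (n + 1) (consAlgHom k H n (d ⊗ₜ t) * a) 1 ∘ₗ
        LinearMap.mulLeft k (x * HopfAlgebra.antipode k y)) := by
  rw [← trace_mulLeft_comp]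
  congr 1
  ext h
  have hc : consAlgHom k H n (d ⊗ₜ t) =
      consAlgHom k H n (d ⊗ₜ 1) * consAlgHom k H n (1 ⊗ₜ t) := by
    rw [← map_mul]; simp
  simp only [LinearMap.comp_apply, LinearMap.mulLeft_apply, LinearMap.mulRight_apply,
    antipodeMulComulPow_apply, iterMul_mul_snocAlgEquiv, mul_one, hc,
    HopfAlgebra.antipode_mul_antidistrib]
  simp only [mul_assoc, iterMul_consAlgHom_mul, HopfAlgebra.antipode_mul_antidistrib]

theorem trace_antipodeMulComulPow (n : ℕ) (a b : ⨂[k]^(n + 1) H) (p q : H ⊗[k] H) :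
    LinearMap.trace k H (LinearMap.mulLeft k (mulAntipodeRight k H p) ∘ₗ
      LinearMap.mulRight k (mulAntipodeLeft k H q) ∘ₗ antipodeMulComulPow (n + 1) a b) =
    rotationTrace k H (n + 1) (comulPowRight k H (n + 1) q * consAlgHom k H (n + 1) (1 ⊗ₜ b) *
      (snocAlgEquiv k H (n + 1) (a ⊗ₜ 1) * comulPowLeft k H (n + 1) p)) := by
  induction p with
  | zero => simp
  | add p p' hp hp' =>
    rw [map_add, map_add, mul_add, mul_add, map_add, ← hp, ← hp']
    refine (congrArg (LinearMap.trace k H) ?_).trans (map_add _ _ _)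
    ext h; simp [add_mul]
  | tmul f g =>
  induction q with
  | zero => simp
  | add q q' hq hq' =>
    rw [map_add, map_add, add_mul, add_mul, map_add, ← hq, ← hq']
    refine (congrArg (LinearMap.trace k H) ?_).trans (map_add _ _ _)
    ext h; simp [mul_add]
  | tmul d e =>
  have key : ∀ b' : ⨂[k]^(n + 1) H, LinearMap.trace k H
      (LinearMap.mulLeft k (f * HopfAlgebra.antipode k g) ∘ₗ
        LinearMap.mulRight k (HopfAlgebra.antipode k d) ∘ₗ antipodeMulComulPow (n + 1) a b') =
      rotationTrace k H (n + 1) (consAlgHom k H (n + 1) (d ⊗ₜ b') *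
        (snocAlgEquiv k H (n + 1) (a ⊗ₜ 1) * comulPowLeft k H (n + 1) (f ⊗ₜ g))) := by
    intro b'
    obtain ⟨z, rfl⟩ := (snocAlgEquiv k H n).surjective b'
    induction z with
    | zero => simp [antipodeMulComulPow]
    | add z z' hz hz' =>
      rw [map_add, TensorProduct.tmul_add, map_add, add_mul, map_add, ← hz, ← hz']
      refine (congrArg (LinearMap.trace k H) ?_).trans (map_add _ _ _)
      ext h; simp [antipodeMulComulPow_apply, mul_add, add_mul]
    | tmul t y =>
      rw [trace_antipodeMulComulPow_pure, consAlgHom_snocAlgEquiv, comulPowLeft_tmul, ← map_mul,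
        ← map_mul, Algebra.TensorProduct.tmul_mul_tmul, Algebra.TensorProduct.tmul_mul_tmul,
        one_mul, rotationTrace_snocAlgEquiv]
      congr 1
      ext h
      simp [antipodeMulComulPow_apply, mul_assoc, HopfAlgebra.antipode_mul_antidistrib]
  have hb : comulPowRight k H (n + 1) (d ⊗ₜ e) * consAlgHom k H (n + 1) (1 ⊗ₜ b) =
      consAlgHom k H (n + 1) (d ⊗ₜ (comulPow k H (n + 1) e * b)) := by
    rw [comulPowRight_tmul, ← map_mul]; simp
  have hr : LinearMap.mulLeft k (mulAntipodeRight k H (f ⊗ₜ[k] g)) ∘ₗ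
      LinearMap.mulRight k (mulAntipodeLeft k H (d ⊗ₜ[k] e)) ∘ₗ antipodeMulComulPow (n + 1) a b =
      LinearMap.mulRight k e ∘ₗ LinearMap.mulLeft k (f * HopfAlgebra.antipode k g) ∘ₗ
        LinearMap.mulRight k (HopfAlgebra.antipode k d) ∘ₗ antipodeMulComulPow (n + 1) a b := by
    ext h; simp [mul_assoc]
  rw [hb, ← key, hr, trace_mulRight_comp]
  congr 1
  ext h
  simp [antipodeMulComulPow_apply, mul_assoc]

theorem rotationTrace_one (n : ℕ) : rotationTrace k H n 1 = indicator k H (n + 1) := by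
  rw [← map_one (snocAlgEquiv k H n), Algebra.TensorProduct.one_def, rotationTrace_snocAlgEquiv,
    indicator]
  congr 1
  ext h
  simp [antipodeMulComulPow_apply, sweedlerPower_eq_iterMul_comulPow, HopfAlgebra.antipode_one]

end TwistTrace

section TwistPower

variable {k : Type u} {H : Type v} [Field k] [Ring H] [HopfAlgebra k H] (c : TwoCocycle k H)

/-- The element `F⁽ⁿ⁾ ∈ H^{⊗ n}` with `Δ_F⁽ⁿ⁾(h) = F⁽ⁿ⁾ Δ⁽ⁿ⁾(h) (F⁽ⁿ⁾)⁻¹`. -/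
def twistPow : (n : ℕ) → (⨂[k]^n H)ˣ
  | 0 => 1
  | n + 1 =>
    Units.map (((consAlgHom k H n).comp Algebra.TensorProduct.includeRight : (⨂[k]^n H) →ₐ[k] _) :
      (⨂[k]^n H) →* ⨂[k]^(n + 1) H) (twistPow n) *
    Units.map (comulPowRight k H n : H ⊗[k] H →* ⨂[k]^(n + 1) H) c.F

theorem val_twistPow_succ (n : ℕ) : ((twistPow c (n + 1) : (⨂[k]^(n + 1) H)ˣ) : ⨂[k]^(n + 1) H) =
    consAlgHom k H n (1 ⊗ₜ (twistPow c n : ⨂[k]^n H)) * comulPowRight k H n c.F := rfl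

theorem val_inv_twistPow_succ (n : ℕ) : (((twistPow c (n + 1))⁻¹ : (⨂[k]^(n + 1) H)ˣ) : ⨂[k]^(n + 1) H) =
    comulPowRight k H n ((c.F⁻¹ : (H ⊗[k] H)ˣ) : H ⊗[k] H) *
      consAlgHom k H n (1 ⊗ₜ (((twistPow c n)⁻¹ : (⨂[k]^n H)ˣ) : ⨂[k]^n H)) := by
  rw [twistPow, mul_inv_rev]
  rfl

theorem TwoCocycle.cocycle' (c : TwoCocycle k H) :
    ((1 : H) ⊗ₜ[k] (c.F : H ⊗[k] H)) * Coalgebra.comul.lTensor H (c.F : H ⊗[k] H) =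
      TensorProduct.assoc k H H H ((c.F : H ⊗[k] H) ⊗ₜ[k] (1 : H)) *
        TensorProduct.assoc k H H H (Coalgebra.comul.rTensor H (c.F : H ⊗[k] H)) := by
  let A := (Algebra.TensorProduct.assoc k k k H H H).toAlgHom
  let L := A.comp (Algebra.TensorProduct.map (Bialgebra.comulAlgHom k H) (AlgHom.id k H))
  let L' := A.comp (Algebra.TensorProduct.includeLeft : H ⊗[k] H →ₐ[k] (H ⊗[k] H) ⊗[k] H)
  have h1 : L ((c.F⁻¹ : (H ⊗[k] H)ˣ) : H ⊗[k] H) * L c.F = 1 := by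
    rw [← map_mul, Units.inv_mul, map_one]
  have h2 : L' ((c.F⁻¹ : (H ⊗[k] H)ˣ) : H ⊗[k] H) * L' c.F = 1 := by
    rw [← map_mul, Units.inv_mul, map_one]
  have h3 := congr($c.cocycle * (L' c.F * L c.F))
  change _ * L _ * L' _ * _ = _ at h3
  rw [one_mul, mul_assoc, ← mul_assoc (L' _) (L' _), h2, one_mul, mul_assoc, h1, mul_one] at h3
  exact h3

theorem comulPowRight_zero_twist : comulPowRight k H 0 (c.F : H ⊗[k] H) = 1 := by
  have h1 : ∀ x : H ⊗[k] H, comulPowRight k H 0 x =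
      consAlgHom k H 0 ((Algebra.TensorProduct.includeLeft : H →ₐ[k] H ⊗[k] (⨂[k]^0 H))
        (TensorProduct.rid k H (Coalgebra.counit.lTensor H x))) := by
    intro x
    induction x with
    | zero => simp
    | tmul x y =>
      simp [comulPow, Algebra.ofId_apply, Algebra.algebraMap_eq_smul_one]
    | add x y hx hy => simp only [map_add, hx, hy]
  rw [h1, c.counit_right, map_one, map_one]

theorem comulPowLeft_zero_twist : comulPowLeft k H 0 (c.F : H ⊗[k] H) = 1 := by
  have h1 : ∀ x : H ⊗[k] H, comulPowLeft k H 0 x =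
      snocAlgEquiv k H 0 ((Algebra.TensorProduct.includeRight : H →ₐ[k] (⨂[k]^0 H) ⊗[k] H)
        (TensorProduct.lid k H (Coalgebra.counit.rTensor H x))) := by
    intro x
    induction x with
    | zero => simp
    | tmul x y =>
      simp [comulPow, Algebra.ofId_apply, Algebra.algebraMap_eq_smul_one, TensorProduct.smul_tmul]
    | add x y hx hy => simp only [map_add, hx, hy]
  rw [h1, c.counit_left, map_one, map_one]

theorem val_twistPow_succ' (n : ℕ) : ((twistPow c (n + 1) : (⨂[k]^(n + 1) H)ˣ) : ⨂[k]^(n + 1) H) =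
    snocAlgEquiv k H n ((twistPow c n : ⨂[k]^n H) ⊗ₜ 1) * comulPowLeft k H n c.F := by
  induction n with
  | zero =>
    rw [val_twistPow_succ, comulPowRight_zero_twist, comulPowLeft_zero_twist]
    simp [twistPow, ← Algebra.TensorProduct.one_def]
  | succ n ih =>
    have h := congr(comulPowMiddle k H n $c.cocycle')
    rw [map_mul, map_mul, comulPowMiddle_includeRight, comulPowMiddle_includeLeft,
      comulPowMiddle_lTensor, comulPowMiddle_rTensor] at h
    have e1 : ∀ s t : ⨂[k]^(n + 1) H, (1 : H) ⊗ₜ[k] (s * t) = (1 ⊗ₜ s) * (1 ⊗ₜ t) := by simp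
    have e2 : ∀ s t : ⨂[k]^(n + 1) H, (s * t) ⊗ₜ[k] (1 : H) = (s ⊗ₜ 1) * (t ⊗ₜ 1) := by simp
    rw [val_twistPow_succ, ih, e1, map_mul, mul_assoc, h, consAlgHom_snocAlgEquiv,
      ← ih, val_twistPow_succ, e2, map_mul, mul_assoc]

/-- Sweedler powers with respect to the twisted comultiplication. -/
theorem iterMul_twistPow (P : ℕ → H →ₗ[k] H) (h0 : P 0 = Algebra.linearMap k H ∘ₗ Coalgebra.counit)
    (hP : ∀ n, P (n + 1) = LinearMap.mul' k H ∘ₗ (P n).lTensor H ∘ₗ (twistComul c).toLinearMap)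
    (n : ℕ) (h : H) :
    P n h = iterMul k H n ((twistPow c n : ⨂[k]^n H) * comulPow k H n h *
      (((twistPow c n)⁻¹ : (⨂[k]^n H)ˣ) : ⨂[k]^n H)) := by
  induction n generalizing h with
  | zero =>
    rw [h0]
    simp [twistPow, comulPow, Algebra.ofId_apply, Algebra.algebraMap_eq_smul_one, iterMul_one]
  | succ n ih =>
    have key : ∀ z : H ⊗[k] H, LinearMap.mul' k H ((P n).lTensor H z) =
        iterMul k H (n + 1) (consAlgHom k H n (1 ⊗ₜ (twistPow c n : ⨂[k]^n H)) *
          comulPowRight k H n z * consAlgHom k H n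
            (1 ⊗ₜ (((twistPow c n)⁻¹ : (⨂[k]^n H)ˣ) : ⨂[k]^n H))) := by
      intro z
      induction z with
      | zero => simp
      | tmul x y =>
        rw [comulPowRight_tmul, ← map_mul, ← map_mul]
        simp [ih, iterMul_consAlgHom]
      | add x y hx hy => simp only [map_add, hx, hy, mul_add, add_mul]
    rw [hP, val_twistPow_succ, val_inv_twistPow_succ, ← comulPowRight_comul]
    simp only [LinearMap.comp_apply, AlgHom.toLinearMap_apply]
    rw [key, twistComul_apply, map_mul (comulPowRight k H n), map_mul (comulPowRight k H n)]
    simp only [mul_assoc]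

theorem trace_twist (n : ℕ) :
    LinearMap.trace k H (LinearMap.mulLeft k (mulAntipodeRight k H c.F) ∘ₗ
      LinearMap.mulRight k (mulAntipodeLeft k H ((c.F⁻¹ : (H ⊗[k] H)ˣ) : H ⊗[k] H)) ∘ₗ
      antipodeMulComulPow (n + 1) (twistPow c (n + 1) : ⨂[k]^(n + 1) H)
        (((twistPow c (n + 1))⁻¹ : (⨂[k]^(n + 1) H)ˣ) : ⨂[k]^(n + 1) H)) =
    indicator k H (n + 2) := by
  rw [trace_antipodeMulComulPow, ← val_twistPow_succ', ← val_inv_twistPow_succ, Units.inv_mul,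
    rotationTrace_one]

end TwistPower

section TwistAntipode

variable {k : Type u} {H : Type v} [Field k] [Ring H] [HopfAlgebra k H]

variable (k) in
/-- The map `x ⊗ y ↦ x w S(y)`. -/
def sandwichAntipode (w : H) : H ⊗[k] H →ₗ[k] H :=
  LinearMap.mul' k H ∘ₗ TensorProduct.map (LinearMap.mulRight k w) (HopfAlgebra.antipode k)

@[simp]
theorem sandwichAntipode_tmul (w x y : H) :
    sandwichAntipode k w (x ⊗ₜ y) = x * w * HopfAlgebra.antipode k y := rfl

theorem sandwichAntipode_mul (w : H) (s t : H ⊗[k] H) :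
    sandwichAntipode k w (s * t) = sandwichAntipode k (sandwichAntipode k w t) s := by
  induction s with
  | zero => simp
  | tmul x y =>
    induction t with
    | zero => simp
    | tmul x' y' => simp [HopfAlgebra.antipode_mul_antidistrib, mul_assoc]
    | add t t' ht ht' =>
      rw [mul_add, map_add, ht, ht']
      simp [mul_add, add_mul]
  | add s s' hs hs' => rw [add_mul, map_add, map_add, hs, hs']

theorem sandwichAntipode_smul_one (r : k) (t : H ⊗[k] H) :
    sandwichAntipode k (r • (1 : H)) t = r • mulAntipodeRight k H t := by
  induction t with
  | zero => simp
  | tmul x y => simp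
  | add s t hs ht => simp only [map_add, hs, ht, smul_add]

theorem sandwichAntipode_one (t : H ⊗[k] H) :
    sandwichAntipode k (1 : H) t = mulAntipodeRight k H t := by
  simpa using sandwichAntipode_smul_one (1 : k) t

theorem mulAntipodeRight_comul (h : H) :
    mulAntipodeRight k H (Coalgebra.comul h) = Coalgebra.counit (R := k) h • (1 : H) := by
  rw [← Algebra.algebraMap_eq_smul_one]
  exact HopfAlgebra.mul_antipode_lTensor_comul_apply h

theorem mulAntipodeLeft_comul (h : H) :
    mulAntipodeLeft k H (Coalgebra.comul h) = Coalgebra.counit (R := k) h • (1 : H) := by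
  rw [← Algebra.algebraMap_eq_smul_one]
  exact HopfAlgebra.mul_antipode_rTensor_comul_apply h

variable (k H) in
/-- The map `x ⊗ y ⊗ z ↦ x S(y) z`. -/
def mulAntipodeMiddle : H ⊗[k] (H ⊗[k] H) →ₗ[k] H :=
  LinearMap.mul' k H ∘ₗ (mulAntipodeLeft k H).lTensor H

theorem mulAntipodeMiddle_mul (x z : H) (s t : H ⊗[k] H) :
    mulAntipodeMiddle k H ((x ⊗ₜ s) * TensorProduct.assoc k H H H (t ⊗ₜ z)) =
      x * mulAntipodeRight k H t * mulAntipodeLeft k H s * z := by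
  induction s with
  | zero => simp
  | tmul a b =>
    induction t with
    | zero => simp
    | tmul a' b' =>
      simp [mulAntipodeMiddle, HopfAlgebra.antipode_mul_antidistrib, mul_assoc]
    | add t t' ht ht' =>
      simp only [TensorProduct.add_tmul, map_add, mul_add, add_mul, ht, ht']
  | add s s' hs hs' =>
    simp only [TensorProduct.tmul_add, map_add, mul_add, add_mul, hs, hs']

theorem mulAntipodeMiddle_lTensor_mul_rTensor (p q : H ⊗[k] H) :
    mulAntipodeMiddle k H (Coalgebra.comul.lTensor H p *
        TensorProduct.assoc k H H H (Coalgebra.comul.rTensor H q)) =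
      TensorProduct.rid k H (Coalgebra.counit.lTensor H p) *
        TensorProduct.lid k H (Coalgebra.counit.rTensor H q) := by
  induction p with
  | zero => simp
  | tmul x y =>
    induction q with
    | zero => simp
    | tmul x' y' =>
      rw [LinearMap.lTensor_tmul, LinearMap.rTensor_tmul, mulAntipodeMiddle_mul,
        mulAntipodeRight_comul, mulAntipodeLeft_comul]
      simp only [LinearMap.lTensor_tmul, LinearMap.rTensor_tmul, TensorProduct.rid_tmul,
        TensorProduct.lid_tmul, mul_smul_comm, smul_mul_assoc, mul_one]
      rw [smul_comm]
    | add t t' ht ht' => simp only [map_add, mul_add, ht, ht']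
  | add s s' hs hs' => simp only [map_add, add_mul, hs, hs']

variable (c : TwoCocycle k H)

theorem mulAntipodeRight_mul_mulAntipodeLeft_twist :
    mulAntipodeRight k H c.F * mulAntipodeLeft k H ((c.F⁻¹ : (H ⊗[k] H)ˣ) : H ⊗[k] H) = 1 := by
  have hl : TensorProduct.lid k H (Coalgebra.counit.rTensor H ((c.F⁻¹ : (H ⊗[k] H)ˣ) : H ⊗[k] H)) =
      1 :=
    map_inv_eq_one ((Algebra.TensorProduct.lid k H).toAlgHom.comp
      (Algebra.TensorProduct.map (Bialgebra.counitAlgHom k H) (AlgHom.id k H)) : H ⊗[k] H →* H)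
      c.F c.counit_left
  have h1 : ((1 : H) ⊗ₜ[k] ((c.F⁻¹ : (H ⊗[k] H)ˣ) : H ⊗[k] H)) * ((1 : H) ⊗ₜ[k] (c.F : H ⊗[k] H)) =
      1 := by
    rw [Algebra.TensorProduct.tmul_mul_tmul, Units.inv_mul, one_mul]; rfl
  let A := (Algebra.TensorProduct.assoc k k k H H H).toAlgHom
  let L' := A.comp (Algebra.TensorProduct.includeLeft : H ⊗[k] H →ₐ[k] (H ⊗[k] H) ⊗[k] H)
  have h2 : L' ((c.F⁻¹ : (H ⊗[k] H)ˣ) : H ⊗[k] H) * L' c.F = 1 := by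
    rw [← map_mul, Units.inv_mul, map_one]
  have h3 := congr(((1 : H) ⊗ₜ[k] ((c.F⁻¹ : (H ⊗[k] H)ˣ) : H ⊗[k] H)) * $c.cocycle * L' c.F)
  change _ * (_ * L' _) * _ = _ at h3
  rw [mul_assoc, mul_assoc _ (L' _), h2, mul_one, mul_one, ← mul_assoc, ← mul_assoc, h1,
    one_mul] at h3
  have h4 := congr(mulAntipodeMiddle k H $h3)
  rw [mulAntipodeMiddle_lTensor_mul_rTensor, c.counit_right, hl] at h4
  change _ = mulAntipodeMiddle k H (_ * TensorProduct.assoc k H H H (_ ⊗ₜ _)) at h4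
  rw [mulAntipodeMiddle_mul] at h4
  simpa using h4.symm

/-- The antipode `h ↦ u S(h) u⁻¹` of the twist. -/
def twistAntipode : H →ₗ[k] H :=
  LinearMap.mulLeft k (mulAntipodeRight k H c.F) ∘ₗ
    LinearMap.mulRight k (mulAntipodeLeft k H ((c.F⁻¹ : (H ⊗[k] H)ˣ) : H ⊗[k] H)) ∘ₗ
      HopfAlgebra.antipode k

theorem mul_twistAntipode_lTensor_twistComul (h : H) :
    LinearMap.mul' k H ((twistAntipode c).lTensor H (twistComul c h)) =
      Coalgebra.counit (R := k) h • (1 : H) := by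
  have h1 : ∀ z, LinearMap.mul' k H ((twistAntipode c).lTensor H z) =
      sandwichAntipode k (mulAntipodeRight k H c.F) z *
        mulAntipodeLeft k H ((c.F⁻¹ : (H ⊗[k] H)ˣ) : H ⊗[k] H) := by
    intro z
    induction z with
    | zero => simp
    | tmul x y => simp [twistAntipode, mul_assoc]
    | add s t hs ht => simp only [map_add, hs, ht, add_mul]
  have h2 : sandwichAntipode k (mulAntipodeRight k H c.F)
      ((c.F⁻¹ : (H ⊗[k] H)ˣ) : H ⊗[k] H) = 1 := by
    rw [← sandwichAntipode_one, ← sandwichAntipode_mul, Units.inv_mul,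
      Algebra.TensorProduct.one_def]
    simp [HopfAlgebra.antipode_one]
  rw [h1, twistComul_apply, sandwichAntipode_mul, h2, sandwichAntipode_mul, sandwichAntipode_one,
    mulAntipodeRight_comul, sandwichAntipode_smul_one, smul_mul_assoc,
    mulAntipodeRight_mul_mulAntipodeLeft_twist]

end TwistAntipode

section Gauge

variable {k : Type u} {H : Type v} {H' : Type w} [Field k] [Ring H] [HopfAlgebra k H]
  [Ring H'] [HopfAlgebra k H']

theorem exists_linearEquiv_of_gaugeEquivalent (h : GaugeEquivalent k H H') :
    ∃ (c : TwoCocycle k H) (e : H' ≃ₗ[k] H), e 1 = 1 ∧ (∀ x y, e (x * y) = e x * e y) ∧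
      (∀ x, Coalgebra.counit (R := k) (e x) = Coalgebra.counit (R := k) x) ∧
      ∀ x, TensorProduct.map e.toLinearMap e.toLinearMap (Coalgebra.comul x) =
        twistComul c (e x) := by
  obtain ⟨c, ⟨e⟩⟩ := h
  refine ⟨c, (e : H' ≃ₐ[k] Twist c).toLinearEquiv, map_one e, map_mul e, fun x => ?_, fun x => ?_⟩
  · exact CoalgHomClass.counit_comp_apply e x
  · exact CoalgHomClass.map_comp_comul_apply e x

theorem indicator_eq_of_gaugeEquivalent (h : GaugeEquivalent k H H') {n : ℕ} (hn : 1 ≤ n) :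
    indicator k H n = indicator k H' n := by
  obtain ⟨n, rfl⟩ := Nat.exists_eq_add_of_le' hn
  obtain ⟨c, e, e_one, e_mul, e_counit, e_comul⟩ := exists_linearEquiv_of_gaugeEquivalent h
  have e_conv : ∀ (f g : H' →ₗ[k] H') (x : H'),
      e (LinearMap.mul' k H' (TensorProduct.map f g (Coalgebra.comul x))) =
        LinearMap.mul' k H (TensorProduct.map (e.conj f) (e.conj g) (twistComul c (e x))) := by
    intro f g x
    rw [← e_comul]
    generalize (Coalgebra.comul x : H' ⊗[k] H') = z
    induction z with
    | zero => simp
    | tmul a b => simp [e_mul, LinearEquiv.conj_apply]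
    | add s t hs ht => simp only [map_add, hs, ht]
  have e_smul_one : ∀ r : k, e (algebraMap k H' r) = r • (1 : H) := by
    intro r
    rw [Algebra.algebraMap_eq_smul_one, map_smul, e_one]
  have hS : e.conj (HopfAlgebra.antipode k) = twistAntipode c := by
    have h1 : WithConv.toConv (LinearMap.id : H' →ₗ[k] H') *
        WithConv.toConv (e.symm.conj (twistAntipode c)) = 1 := by
      ext x
      apply e.injective
      rw [LinearMap.convMul_apply, LinearMap.convOne_apply, e_smul_one, ← e_counit,
        ← mul_twistAntipode_lTensor_twistComul c]
      refine (e_conv _ _ x).trans ?_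
      rw [LinearMap.lTensor]
      congr 3
      · ext; simp [LinearEquiv.conj_apply]
      · ext; simp [LinearEquiv.conj_apply]
    have h2 := left_inv_eq_right_inv LinearMap.antipode_mul_id h1
    rw [WithConv.toConv_injective h2]
    ext; simp [LinearEquiv.conj_apply]
  have hP : ∀ n h, e.conj (sweedlerPower k H' n) h = iterMul k H n
      ((twistPow c n : ⨂[k]^n H) * comulPow k H n h *
        (((twistPow c n)⁻¹ : (⨂[k]^n H)ˣ) : ⨂[k]^n H)) := by
    refine iterMul_twistPow c (fun n => e.conj (sweedlerPower k H' n)) ?_ fun n => ?_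
    · ext x
      simp [LinearEquiv.conj_apply, sweedlerPower, e_one, Algebra.algebraMap_eq_smul_one,
        ← e_counit]
    · ext x
      obtain ⟨y, rfl⟩ := e.surjective x
      have h1 := congr(($(toConv_sweedlerPower (k := k) (H := H') (n + 1))) y)
      rw [pow_succ', ← toConv_sweedlerPower, LinearMap.convMul_apply] at h1
      change sweedlerPower k H' (n + 1) y = _ at h1
      simp only [LinearEquiv.conj_apply_apply, LinearEquiv.symm_apply_apply, h1]
      refine (e_conv _ _ y).trans ?_
      simp only [LinearMap.comp_apply, LinearMap.lTensor, AlgHom.toLinearMap_apply]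
      congr 3
      ext; simp [LinearEquiv.conj_apply]
  have htr : indicator k H' (n + 1) =
      LinearMap.trace k H (twistAntipode c ∘ₗ e.conj (sweedlerPower k H' n)) := by
    rw [indicator, ← LinearMap.trace_conj' _ e, ← hS, ← LinearEquiv.conj_comp]
    rfl
  rw [htr]
  cases n with
  | zero =>
    rw [indicator]
    congr 1
    ext x
    have h1 : twistAntipode c 1 = 1 := by
      simpa [twistAntipode, HopfAlgebra.antipode_one] using
        mulAntipodeRight_mul_mulAntipodeLeft_twist c
    rw [LinearMap.comp_apply (twistAntipode c), hP]
    simp [twistPow, sweedlerPower_eq_iterMul_comulPow, comulPow, Algebra.ofId_apply,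
      Algebra.algebraMap_eq_smul_one, iterMul_one, h1, HopfAlgebra.antipode_one]
  | succ n =>
    rw [← trace_twist c n]
    congr 1
    ext x
    rw [LinearMap.comp_apply (twistAntipode c), hP]
    simp [twistAntipode, antipodeMulComulPow_apply]

end Gauge

end

end HopfIndicator

theorem theorem2p2 (k : Type u) (H : Type v) [Field k] [Ring H] [HopfAlgebra k H]
    [FiniteDimensional k H] :
    (∀ (H' : Type w) [Ring H'] [HopfAlgebra k H'],
      HopfIndicator.GaugeEquivalent k H H' →
        ∀ n : ℕ, 1 ≤ n → HopfIndicator.indicator k H n = HopfIndicator.indicator k H' n) ∧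
    (∀ (l : H →ₗ[k] k) (Λ : H),
      HopfIndicator.IsRightIntegralDual k l → HopfIndicator.IsLeftIntegral k Λ → l Λ = 1 →
        ∀ n : ℕ, 1 ≤ n →
          HopfIndicator.indicator k H n =
            l (HopfAlgebra.antipode k (HopfIndicator.sweedlerPower k H n Λ))) := by
  refine ⟨fun H' _ _ h n hn => HopfIndicator.indicator_eq_of_gaugeEquivalent h hn,
    fun l Λ hl hΛ h1 n hn => HopfIndicator.indicator_eq_integral hl hΛ h1 hn⟩
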